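/- Let $\Gamma$ be a finite abelian group with character group $\widehat\Gamma=\mathrm{Hom}(\Gamma,\mathbb C^{*})$. A homogeneous space $M=G/H$ ($G$ a real Lie group, $H$ a closed subgroup) is called $\Gamma$-symmetric if $G$ is connected, if the Lie algebra $\mathfrak h$ of $H$ contains no nonzero proper ideal of the Lie algebra $\mathfrak g$ of $G$, and if there is an injective homomorphism $\rho:\Gamma\to\mathrm{Aut}\,G$, $\gamma\mapsto\rho_\gamma$, into the group of Lie group automorphisms of $G$ such that $(G^\Gamma)_e\subseteq H\subseteq G^\Gamma$, where $G^\Gamma$ is the subgroup of the elements of $G$ fixed by all $\rho_\gamma$ and $(G^\Gamma)_e$ is its identity component. **Proposition.** Let $M=G/H$ be a $\Gamma$-symmetric space by means of $\rho$. Then $\tau(\gamma)=(T\rho_\gamma)_e$ defines an injective homomorphism $\tau:\Gamma\to\mathrm{Aut}(\mathfrak g)$, and: 1. The complex Lie algebra $\mathfrak g_{\mathbb C}=\mathfrak g\otimes_{\mathbb R}\mathbb C$ is graded by $\widehat\Gamma$, with components $$(\mathfrak g_{\mathbb C})_\chi=\{X\in\mathfrak g_{\mathbb C} : \tau(\gamma)_{\mathbb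 C}X=\chi(\gamma)X\ \text{ for all }\gamma\in\Gamma\},\qquad \chi\in\widehat\Gamma,$$ where $\tau(\gamma)_{\mathbb C}$ is the complex linear extension of $\tau(\gamma)$. That is, $\mathfrak g_{\mathbb C}=\bigoplus_{\chi\in\widehat\Gamma}(\mathfrak g_{\mathbb C})_\chi$ and $[(\mathfrak g_{\mathbb C})_\chi,(\mathfrak g_{\mathbb C})_\psi]\subseteq(\mathfrak g_{\mathbb C})_{\chi\psi}$ for all $\chi,\psi\in\widehat\Gamma$. The subgroup of $\widehat\Gamma$ generated by the support $\{\chi\in\widehat\Gamma : (\mathfrak g_{\mathbb C})_\chi\neq\{0\}\}$ is $\widehat\Gamma$ itself. 2. If $\Gamma\cong\mathbb Z_2^k$ for some $k\ge 0$ (so that every $\chi\in\widehat\Gamma$ takes its values in $\{1,-1\}$), then the real Lie algebra $\mathfrak g$ is graded by $\widehat\Gamma$, with components $\mathfrak g_\chi=\{X\in\mathfrak g : \tau(\gamma)X=\chi(\gamma)X\ \text{ for all }\gamma\in\Gamma\}$, and the support $\{\chi\in\widehat\Gamma : \mathfrak g_\chi\neq\{0\}\}$ of this grading generates $\widehat\Gamma$.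 -/

import Mathlib

open scoped Manifold ContDiff TensorProduct

noncomputable section

/-! ### Automorphism groups -/

/-- The group `Aut L` of automorphisms of a Lie algebra, the product being composition. -/
instance LieEquiv.instAutGroup {R L : Type*} [CommRing R] [LieRing L] [LieAlgebra R L] :
    Group (L ≃ₗ⁅R⁆ L) where
  mul f g := g.trans f
  one := 1
  inv f := f.symm
  mul_assoc _ _ _ := rfl
  one_mul _ := rfl
  mul_one _ := rfl
  inv_mul_cancel f := LieEquiv.self_trans_symm f

/-- A smooth Lie group has the regularity that Mathlib requires for its Lie algebra. -/
instance instLEInftyMinSmoothnessThree : ENat.LEInfty (minSmoothness ℝ 3) where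
  out := by
    rw [minSmoothness_of_isRCLikeNormedField]
    exact ENat.LEInfty.out

section LieGroups

variable (n : ℕ) (G : Type*) [Group G] [TopologicalSpace G]
  [ChartedSpace (EuclideanSpace ℝ (Fin n)) G]

/-- The group `Aut G` of automorphisms of an `n`-dimensional Lie group `G`: the group
automorphisms that are smooth together with their inverse. -/
def LieGroupAut : Subgroup (MulAut G) where
  carrier := {f | ContMDiff (𝓡 n) (𝓡 n) ∞ (fun x : G => f x) ∧
    ContMDiff (𝓡 n) (𝓡 n) ∞ (fun x : G => f⁻¹ x)}
  mul_mem' := by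
    rintro f g ⟨hf, hf'⟩ ⟨hg, hg'⟩
    refine ⟨hf.comp hg, ?_⟩
    rw [mul_inv_rev]
    exact hg'.comp hf'
  one_mem' := by
    refine ⟨contMDiff_id, ?_⟩
    rw [inv_one]
    exact contMDiff_id
  inv_mem' := by
    rintro f ⟨hf, hf'⟩
    refine ⟨hf', ?_⟩
    rwa [inv_inv]

variable {n G}

/-- The tangent map `(T f)_1 : 𝔤 → 𝔤` at the identity of an automorphism `f` of `G`. -/
def LieGroupAut.tangentMapOne (f : LieGroupAut n G) (X : GroupLieAlgebra (𝓡 n) G) :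
    GroupLieAlgebra (𝓡 n) G :=
  mfderiv (𝓡 n) (𝓡 n) (fun x : G => f.1 x) (1 : G) X

/-- The subgroup `G^Γ` of the elements of `G` fixed by all the automorphisms `ρ γ`. -/
def fixedSubgroup {Γ : Type*} [Group Γ] (ρ : Γ →* LieGroupAut n G) : Subgroup G where
  carrier := {g | ∀ γ : Γ, (ρ γ).1 g = g}
  mul_mem' := by
    intro a b ha hb γ
    rw [map_mul, ha γ, hb γ]
  one_mem' := fun γ => map_one _
  inv_mem' := by
    intro a ha γ
    rw [map_inv, ha γ]

variable (n) in
/-- The Lie algebra `𝔥 ⊆ 𝔤` of a closed subgroup `H` of `G`: the set of the initial velocities of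
the smooth one-parameter subgroups of `G` that stay in `H`. -/
def subgroupLieAlgebra (H : Subgroup G) : Set (GroupLieAlgebra (𝓡 n) G) :=
  {X | ∃ c : ℝ → G, ContMDiff 𝓘(ℝ, ℝ) (𝓡 n) ∞ c ∧ (∀ s t : ℝ, c (s + t) = c s * c t) ∧
    (∀ t : ℝ, c t ∈ H) ∧ mfderiv 𝓘(ℝ, ℝ) (𝓡 n) c (0 : ℝ) (1 : ℝ) = X}

/-- The homogeneous space `G/H` is `Γ`-symmetric, by means of the homomorphism
`ρ : Γ → Aut G`. -/
structure IsGammaSymmetricSpace [LieGroup (𝓡 n) ∞ G] {Γ : Type*} [CommGroup Γ] [Finite Γ]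
    (H : Subgroup G) (ρ : Γ →* LieGroupAut n G) : Prop where
  /-- `G/H` is a homogeneous space of `G`. -/
  isClosed : IsClosed (H : Set G)
  /-- `G` is connected. -/
  connected : ConnectedSpace G
  /-- `G` is effective on `G/H`: `𝔥` contains no nonzero proper ideal of `𝔤`. -/
  effective : ∀ J : LieIdeal ℝ (GroupLieAlgebra (𝓡 n) G),
    J ≠ ⊤ → (J : Set (GroupLieAlgebra (𝓡 n) G)) ⊆ subgroupLieAlgebra n H → J = ⊥
  /-- `ρ` is injective. -/
  injective : Function.Injective ρ
  /-- The identity component of `G^Γ` is contained in `H`. -/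
  identityComponent_subset : connectedComponentIn (fixedSubgroup ρ : Set G) 1 ⊆ (H : Set G)
  /-- `H` is contained in `G^Γ`. -/
  le_fixedSubgroup : H ≤ fixedSubgroup ρ

end LieGroups

section Gradings

open Classical in
/-- The family `𝒜` of submodules is a grading of the Lie algebra `L` by the (multiplicatively
written) abelian group `P`: `L = ⨁ p, 𝒜 p` and `[𝒜 p, 𝒜 q] ⊆ 𝒜 (p * q)`. -/
def IsLieGrading {P R L : Type*} [CommGroup P] [CommRing R] [LieRing L] [LieAlgebra R L]
    (𝒜 : P → Submodule R L) : Prop :=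
  Nonempty (GradedLieAlgebra fun p : Additive P => 𝒜 p.toMul)

/-- The support of a family of submodules. -/
def gradingSupport {P R L : Type*} [CommRing R] [LieRing L] [LieAlgebra R L]
    (𝒜 : P → Submodule R L) : Set P :=
  {p | 𝒜 p ≠ ⊥}

variable {Γ L : Type*} [CommGroup Γ] [LieRing L] [LieAlgebra ℝ L]

/-- For an action `τ` of `Γ` on a real Lie algebra `L` and a complex character `χ` of `Γ`, the
component of degree `χ` of the complexification:
`{X ∈ ℂ ⊗ L | γ(X) = χ(γ) X for all γ ∈ Γ}`. -/
def complexComponent (τ : Γ →* (L ≃ₗ⁅ℝ⁆ L)) (χ : Γ →* ℂˣ) : Submodule ℂ (ℂ ⊗[ℝ] L) where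
  carrier := {X | ∀ γ : Γ, ((τ γ : L →ₗ[ℝ] L).baseChange ℂ) X = (χ γ : ℂ) • X}
  add_mem' := by
    intro X Y hX hY γ
    rw [map_add, hX γ, hY γ, smul_add]
  zero_mem' := by
    intro γ
    rw [map_zero, smul_zero]
  smul_mem' := by
    intro c X hX γ
    rw [map_smul, hX γ, smul_comm]

/-- The real elements of the component of degree `χ`: the `X ∈ L` with
`1 ⊗ γ(X) = χ(γ) ⊗ X` for all `γ ∈ Γ`. If `χ` takes only the values `1` and `-1`, this is
`{X ∈ L | γ(X) = χ(γ) X for all γ ∈ Γ}`. -/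
def realComponent (τ : Γ →* (L ≃ₗ⁅ℝ⁆ L)) (χ : Γ →* ℂˣ) : Submodule ℝ L :=
  ((complexComponent τ χ).restrictScalars ℝ).comap (TensorProduct.mk ℝ ℂ L 1)

end Gradings

end

/-!
The differential at the identity turns `ρ` into an action `τ` of `Γ` on `𝔤` by Lie algebra
automorphisms: pulling back by an automorphism `f` of `G` carries the left-invariant vector field
of `df(X)` to that of `X` (`LieGroupAut.mpullback_mulInvariantVectorField_tangentMapOne`), and
pullbacks commute with brackets of vector fields.

The action `τ` is faithful. If `f = ρ γ` has differential the identity, then so have all its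
powers, and averaging a chart `φ` at `1` over the finite cyclic group generated by `f` gives an
`f`-invariant map `∑ k, φ ∘ f ^ k`, whose differential at `1` is a nonzero multiple of the identity.
It is therefore injective near `1`, so `f` fixes a neighbourhood of `1`
(`LieGroupAut.eventually_eq_self`). The fixed points of `f` form an open, hence closed, subgroup of
the connected group `G`, and `f = 1`. This linearization needs no exponential map.

The gradings are representation theory of the finite abelian group `Γ`. Let the characters of `Γ`
have values in a field of characteristic zero. The operators `|Γ|⁻¹ ∑ γ, χ(γ⁻¹) σ(γ)` are, by the
orthogonality relations, a complete system of projections onto the weight spaces of a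
representation `σ`, and the weights multiply under the bracket because `σ(γ)` preserves it
(`isLieGrading_weightSubmodule`). If the support of the grading generated a proper subgroup of the
character group, then by duality some `γ ≠ 1` would be sent to `1` by every character in the
support, so `σ(γ)` would be the identity, against faithfulness (`closure_support_weightSubmodule`).
This is applied to the complexification, and, when `Γ` has exponent dividing `2`, to `𝔤` itself: the
characters then take the values `1` and `-1` and may be read in `ℝ`. For this reason the lemmas on
weights take a homomorphism `c` from complex characters of `Γ` to `K`-valued ones such that
`c χ γ = 1` exactly when `χ γ = 1`.
-/

open scoped Manifold ContDiff TensorProduct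

/-! ### Decompositions from projections -/

/-- A family of submodules `𝒜` with projections `p i` onto `𝒜 i` that kill the other `𝒜 j` and add
up to the identity is a decomposition. -/
@[reducible]
def decompositionOfProjections {ι K V : Type*} [Fintype ι] [DecidableEq ι] [CommRing K]
    [AddCommGroup V] [Module K V] (𝒜 : ι → Submodule K V) (p : ι → V →ₗ[K] V)
    (hmem : ∀ i x, p i x ∈ 𝒜 i) (hsum : ∀ x, ∑ i, p i x = x)
    (hp : ∀ i j, ∀ x ∈ 𝒜 i, p j x = if j = i then x else 0) :
    DirectSum.Decomposition 𝒜 :=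
  DirectSum.Decomposition.ofLinearMap 𝒜
    (∑ i, DirectSum.lof K ι (fun i => 𝒜 i) i ∘ₗ (p i).codRestrict (𝒜 i) (hmem i))
    (by
      ext x
      simpa [LinearMap.sum_apply] using hsum x)
    (by
      ext i x : 2
      have h : ∀ j, (p j).codRestrict (𝒜 j) (hmem j) (x : V) = if h : i = j then h ▸ x else 0 := by
        intro j
        apply Subtype.ext
        rw [LinearMap.codRestrict_apply, hp i j x x.2]
        by_cases hij : i = j
        · subst hij; simp
        · simp [hij, Ne.symm hij]
      simp only [LinearMap.comp_apply, DirectSum.coeLinearMap_lof, LinearMap.sum_apply, h,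
        LinearMap.id_apply]
      rw [Finset.sum_eq_single i]
      · simp
      · intro j _ hj
        simp [Ne.symm hj]
      · simp)

/-! ### Weight spaces of representations of finite abelian groups -/

section Weights

variable {Γ K V : Type*} [CommGroup Γ] [Field K] [AddCommGroup V] [Module K V]

/-- The weight space of `σ` for `φ`: the vectors on which every `γ` acts as the scalar `φ γ`. -/
def weightSubmodule (σ : Γ →* Module.End K V) (φ : Γ →* K) : Submodule K V where
  carrier := {x | ∀ γ, σ γ x = φ γ • x}
  add_mem' := by
    intro x y hx hy γ
    rw [map_add, hx γ, hy γ, smul_add]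
  zero_mem' := by
    intro γ
    rw [map_zero, smul_zero]
  smul_mem' := by
    intro a x hx γ
    rw [map_smul, hx γ, smul_comm]

instance finite_complexCharacters [Finite Γ] : Finite (Γ →* ℂˣ) :=
  .of_equiv _ (CommGroup.monoidHom_mulEquiv_of_hasEnoughRootsOfUnity Γ ℂ).some.symm.toEquiv

theorem sum_character_eq_ite [Fintype Γ] (c : (Γ →* ℂˣ) →* Γ →* K)
    (hc : ∀ χ γ, c χ γ = 1 ↔ χ γ = 1) (χ : Γ →* ℂˣ) [Decidable (χ = 1)] :
    ∑ γ, c χ γ = if χ = 1 then (Nat.card Γ : K) else 0 := by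
  split_ifs with h
  · simp [h]
  · refine sum_hom_units_eq_zero _ fun h' => h ?_
    ext1 γ
    exact (hc χ γ).1 (by rw [h', MonoidHom.one_apply])

theorem sum_characters_apply_eq_ite [Finite Γ] [Fintype (Γ →* ℂˣ)] (c : (Γ →* ℂˣ) →* Γ →* K)
    (hc : ∀ χ γ, c χ γ = 1 ↔ χ γ = 1) (γ : Γ) [Decidable (γ = 1)] :
    ∑ χ, c χ γ = if γ = 1 then (Nat.card Γ : K) else 0 := by
  split_ifs with h
  · simp [h, ← CommGroup.card_monoidHom_of_hasEnoughRootsOfUnity Γ ℂ]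
  · obtain ⟨χ, hχ⟩ := CommGroup.exists_apply_ne_one_of_hasEnoughRootsOfUnity Γ ℂ h
    refine sum_hom_units_eq_zero ((MonoidHom.eval γ).comp c) fun h' => hχ ?_
    exact (hc χ γ).1 (DFunLike.congr_fun h' χ)

/-- The operator `|Γ|⁻¹ ∑ γ, φ(γ⁻¹) σ(γ)`, which averages `σ` against the inverse of `φ`; it is the
projection onto the weight space of `φ`. -/
noncomputable def weightProjection [Fintype Γ] (σ : Γ →* Module.End K V) (φ : Γ →* K) :
    Module.End K V :=
  (Nat.card Γ : K)⁻¹ • ∑ γ, φ γ⁻¹ • σ γ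

theorem weightProjection_apply [Fintype Γ] (σ : Γ →* Module.End K V) (φ : Γ →* K) (x : V) :
    weightProjection σ φ x = (Nat.card Γ : K)⁻¹ • ∑ γ, φ γ⁻¹ • σ γ x := by
  simp [weightProjection, LinearMap.sum_apply]

theorem weightProjection_mem [Fintype Γ] (σ : Γ →* Module.End K V) (φ : Γ →* K) (x : V) :
    weightProjection σ φ x ∈ weightSubmodule σ φ := by
  intro δ
  rw [weightProjection_apply, map_smul, smul_comm (φ δ), map_sum, Finset.smul_sum (r := φ δ)]
  congr 1
  refine Fintype.sum_equiv (Equiv.mulLeft δ) (fun γ => σ δ (φ γ⁻¹ • σ γ x))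
    (fun γ => φ δ • φ γ⁻¹ • σ γ x) fun γ => ?_
  rw [map_smul, smul_smul, Equiv.coe_mulLeft, ← map_mul φ, mul_inv, mul_inv_cancel_left,
    map_mul σ, Module.End.mul_apply]

/-- The projections are complete: this is the orthogonality of the columns of the character
table. -/
theorem sum_weightProjection [CharZero K] [Fintype Γ] [Fintype (Γ →* ℂˣ)] (σ : Γ →* Module.End K V)
    (c : (Γ →* ℂˣ) →* Γ →* K) (hc : ∀ χ γ, c χ γ = 1 ↔ χ γ = 1) (x : V) :
    ∑ χ, weightProjection σ (c χ) x = x := by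
  classical
  have hΓ : (Nat.card Γ : K) ≠ 0 := Nat.cast_ne_zero.2 Nat.card_pos.ne'
  simp_rw [weightProjection_apply, ← Finset.smul_sum]
  rw [Finset.sum_comm]
  simp_rw [← Finset.sum_smul, sum_characters_apply_eq_ite c hc, inv_eq_one]
  simp

/-- The projections restrict to `1` on their own weight space and to `0` on the others: this is the
orthogonality of characters. -/
theorem weightProjection_eq_ite [CharZero K] [Fintype Γ] [DecidableEq (Γ →* ℂˣ)]
    (σ : Γ →* Module.End K V) (c : (Γ →* ℂˣ) →* Γ →* K)
    (hc : ∀ χ γ, c χ γ = 1 ↔ χ γ = 1) (χ ψ : Γ →* ℂˣ) {x : V}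
    (hx : x ∈ weightSubmodule σ (c χ)) :
    weightProjection σ (c ψ) x = if ψ = χ then x else 0 := by
  have hΓ : (Nat.card Γ : K) ≠ 0 := Nat.cast_ne_zero.2 Nat.card_pos.ne'
  have h : ∀ γ, c ψ γ⁻¹ • σ γ x = c (ψ⁻¹ * χ) γ • x := by
    intro γ
    rw [hx γ, smul_smul, map_mul, MonoidHom.mul_apply]
    congr 2
    -- both sides are inverse to `c ψ γ`
    have h1 : c ψ γ⁻¹ * c ψ γ = 1 := by rw [← map_mul, inv_mul_cancel, map_one]
    have h2 : c ψ γ * c ψ⁻¹ γ = 1 := by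
      rw [← MonoidHom.mul_apply, ← map_mul, mul_inv_cancel ψ, map_one, MonoidHom.one_apply]
    exact left_inv_eq_right_inv h1 h2
  rw [weightProjection_apply]
  simp_rw [h, ← Finset.sum_smul, sum_character_eq_ite c hc, ite_smul]
  rw [if_congr (inv_mul_eq_one (a := ψ) (b := χ)) rfl rfl]
  split_ifs
  · rw [smul_smul, inv_mul_cancel₀ hΓ, one_smul]
  · simp

/-- A subgroup of the character group whose annihilator in `Γ` is trivial is everything, by
duality. -/
theorem Subgroup.eq_top_of_forall_character [Finite Γ] (S : Subgroup (Γ →* ℂˣ))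
    (h : ∀ γ : Γ, (∀ χ ∈ S, χ γ = 1) → γ = 1) : S = ⊤ := by
  apply OrderDual.toDual.injective
  apply (CommGroup.subgroupOrderIsoSubgroupMonoidHom Γ ℂ).symm.injective
  ext γ
  simp only [CommGroup.mem_subgroupOrderIsoSubgroupMonoidHom_symm_iff]
  refine ⟨fun hγ => ?_, fun hγ χ _ => hγ χ (Subgroup.mem_top χ)⟩
  simp [h γ hγ]

/-- If the representation is faithful, its weights generate the character group: an element of `Γ`
sent to `1` by all weights acts trivially on each weight space, hence everywhere. -/
theorem closure_support_weightSubmodule [Finite Γ] [CharZero K] {L : Type*} [LieRing L]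
    [LieAlgebra K L] (σ : Γ →* Module.End K L) (hσ : Function.Injective σ)
    (c : (Γ →* ℂˣ) →* Γ →* K) (hc : ∀ χ γ, c χ γ = 1 ↔ χ γ = 1) :
    Subgroup.closure (gradingSupport fun χ => weightSubmodule σ (c χ)) = ⊤ := by
  refine Subgroup.eq_top_of_forall_character _ fun γ hγ => hσ ?_
  have := Fintype.ofFinite Γ
  have := Fintype.ofFinite (Γ →* ℂˣ)
  ext x
  rw [map_one, ← sum_weightProjection σ c hc x, map_sum, map_sum]
  refine Finset.sum_congr rfl fun χ _ => ?_
  have hmem := weightProjection_mem σ (c χ) x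
  by_cases h : weightSubmodule σ (c χ) = ⊥
  · rw [h, Submodule.mem_bot] at hmem
    simp [hmem]
  · rw [hmem γ, (hc χ γ).2 (hγ χ (Subgroup.subset_closure h)), one_smul, Module.End.one_apply]

theorem isLieGrading_weightSubmodule [Finite Γ] [CharZero K] {L : Type*} [LieRing L]
    [LieAlgebra K L] (σ : Γ →* Module.End K L) (hσ : ∀ γ x y, σ γ ⁅x, y⁆ = ⁅σ γ x, σ γ y⁆)
    (c : (Γ →* ℂˣ) →* Γ →* K) (hc : ∀ χ γ, c χ γ = 1 ↔ χ γ = 1) :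
    IsLieGrading fun χ => weightSubmodule σ (c χ) := by
  classical
  have := Fintype.ofFinite Γ
  have := Fintype.ofFinite (Γ →* ℂˣ)
  unfold IsLieGrading
  have hb : SetLike.GradedBracket
      fun p : Additive (Γ →* ℂˣ) => weightSubmodule σ (c p.toMul) := by
    refine ⟨fun p q x y hx hy γ => ?_⟩
    rw [hσ, hx γ, hy γ, toMul_add, map_mul, MonoidHom.mul_apply, smul_lie, lie_smul, smul_smul]
  have D := decompositionOfProjections
    (fun p : Additive (Γ →* ℂˣ) => weightSubmodule σ (c p.toMul))
    (fun p => weightProjection σ (c p.toMul))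
    (fun p x => weightProjection_mem σ _ x)
    (fun x => by
      rw [← Additive.ofMul.sum_comp]
      exact sum_weightProjection σ c hc x)
    (fun p q x hx => weightProjection_eq_ite σ c hc p.toMul q.toMul hx)
  -- `convert` reconciles the decidable equality of the definition of a grading with the one in use
  convert (⟨{ hb, D with }⟩ : Nonempty (GradedLieAlgebra
    fun p : Additive (Γ →* ℂˣ) => weightSubmodule σ (c p.toMul)))

end Weights

/-! ### Actions on a real Lie algebra and on its complexification -/

section Actions

variable {Γ L : Type*} [CommGroup Γ] [LieRing L] [LieAlgebra ℝ L]

/-- The linear action on `L` underlying an action by automorphisms. -/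
noncomputable def linearAction (τ : Γ →* (L ≃ₗ⁅ℝ⁆ L)) : Γ →* Module.End ℝ L where
  toFun γ := (τ γ : L →ₗ[ℝ] L)
  map_one' := by ext x; rw [map_one]; rfl
  map_mul' γ δ := by ext x; rw [map_mul]; rfl

/-- The complex linear extension of an action by automorphisms of a real Lie algebra. -/
noncomputable def complexLinearAction (τ : Γ →* (L ≃ₗ⁅ℝ⁆ L)) : Γ →* Module.End ℂ (ℂ ⊗[ℝ] L) where
  toFun γ := (linearAction τ γ).baseChange ℂ
  map_one' := by rw [map_one]; exact LinearMap.baseChange_id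
  map_mul' γ δ := by rw [map_mul]; exact LinearMap.baseChange_mul _ _

theorem complexLinearAction_lie (τ : Γ →* (L ≃ₗ⁅ℝ⁆ L)) (γ : Γ) (X Y : ℂ ⊗[ℝ] L) :
    complexLinearAction τ γ ⁅X, Y⁆ = ⁅complexLinearAction τ γ X, complexLinearAction τ γ Y⁆ :=
  (LieAlgebra.ExtendScalars.map (AlgHom.id ℝ ℂ) (τ γ).toLieHom).map_lie X Y

theorem one_tmul_injective : Function.Injective (TensorProduct.mk ℝ ℂ L 1) :=
  Module.FaithfullyFlat.tensorProduct_mk_injective L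

theorem linearAction_injective {τ : Γ →* (L ≃ₗ⁅ℝ⁆ L)} (hτ : Function.Injective τ) :
    Function.Injective (linearAction τ) := by
  intro γ δ h
  apply hτ
  ext x
  exact LinearMap.congr_fun h x

theorem complexLinearAction_injective {τ : Γ →* (L ≃ₗ⁅ℝ⁆ L)} (hτ : Function.Injective τ) :
    Function.Injective (complexLinearAction τ) := by
  intro γ δ h
  apply linearAction_injective hτ
  ext x
  exact one_tmul_injective (LinearMap.congr_fun h (1 ⊗ₜ x))

/-- A complex character, seen as a homomorphism to the multiplicative monoid `ℂ`. -/
noncomputable def complexWeight : (Γ →* ℂˣ) →* Γ →* ℂ where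
  toFun χ := (Units.coeHom ℂ).comp χ
  map_one' := rfl
  map_mul' _ _ := rfl

theorem complexWeight_eq_one_iff (χ : Γ →* ℂˣ) (γ : Γ) : complexWeight χ γ = 1 ↔ χ γ = 1 :=
  Units.val_eq_one

theorem complexComponent_eq (τ : Γ →* (L ≃ₗ⁅ℝ⁆ L)) :
    complexComponent τ = fun χ => weightSubmodule (complexLinearAction τ) (complexWeight χ) := rfl

theorem val_eq_ofReal_re_of_sq_eq_one {z : ℂˣ} (h : z ^ 2 = 1) : ((z : ℂ).re : ℂ) = z := by
  have h' : (z : ℂ) ^ 2 = 1 := by rw [← Units.val_pow_eq_pow_val, h, Units.val_one]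
  rcases sq_eq_one_iff.1 h' with h | h <;> simp [h]

/-- If `Γ` has exponent dividing `2`, its complex characters take only the values `1` and `-1`, and
taking real parts makes them real-valued characters. -/
noncomputable def realWeight (hΓ : ∀ γ : Γ, γ ^ 2 = 1) : (Γ →* ℂˣ) →* Γ →* ℝ :=
  have key : ∀ (χ : Γ →* ℂˣ) (γ : Γ), ((χ γ : ℂ).re : ℂ) = χ γ := fun χ γ =>
    val_eq_ofReal_re_of_sq_eq_one (by rw [← map_pow, hΓ, map_one])
  { toFun := fun χ =>
      { toFun := fun γ => (χ γ : ℂ).re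
        map_one' := by simp
        map_mul' := fun γ δ => Complex.ofReal_injective (by
          rw [Complex.ofReal_mul, key, key, key, map_mul, Units.val_mul]) }
    map_one' := by ext γ; simp
    map_mul' := fun χ ψ => by
      ext γ
      refine Complex.ofReal_injective ?_
      simp only [MonoidHom.coe_mk, OneHom.coe_mk, MonoidHom.mul_apply, Complex.ofReal_mul]
      rw [key χ, key ψ, ← MonoidHom.mul_apply, key (χ * ψ)]; rfl }

theorem ofReal_realWeight (hΓ : ∀ γ : Γ, γ ^ 2 = 1) (χ : Γ →* ℂˣ) (γ : Γ) :
    (realWeight hΓ χ γ : ℂ) = χ γ :=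
  val_eq_ofReal_re_of_sq_eq_one (by rw [← map_pow, hΓ, map_one])

theorem realWeight_eq_one_iff (hΓ : ∀ γ : Γ, γ ^ 2 = 1) (χ : Γ →* ℂˣ) (γ : Γ) :
    realWeight hΓ χ γ = 1 ↔ χ γ = 1 := by
  rw [← Complex.ofReal_eq_one, ofReal_realWeight, Units.val_eq_one]

theorem realComponent_eq (τ : Γ →* (L ≃ₗ⁅ℝ⁆ L)) (hΓ : ∀ γ : Γ, γ ^ 2 = 1) :
    realComponent τ = fun χ => weightSubmodule (linearAction τ) (realWeight hΓ χ) := by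
  funext χ
  ext x
  refine forall_congr' fun γ => ?_
  rw [← one_tmul_injective.eq_iff (a := linearAction τ γ x), map_smul, ← ofReal_realWeight hΓ]
  exact Iff.rfl

end Actions

/-! ### The tangent action of automorphisms of a Lie group -/

namespace LieGroupAut

open VectorField

variable {n : ℕ} {G : Type*} [Group G] [TopologicalSpace G]
  [ChartedSpace (EuclideanSpace ℝ (Fin n)) G]

theorem mdifferentiableAt (f : LieGroupAut n G) (x : G) :
    MDifferentiableAt (𝓡 n) (𝓡 n) (fun x : G => f.1 x) x :=
  f.2.1.mdifferentiable (by simp) x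

theorem map_one (f : LieGroupAut n G) : f.1 (1 : G) = 1 :=
  _root_.map_one f.1

/-- The derivative of `f` at `x`, read in the common model `EuclideanSpace ℝ (Fin n)` of all
tangent spaces. -/
noncomputable def derivAt (f : LieGroupAut n G) (x : G) :
    EuclideanSpace ℝ (Fin n) →L[ℝ] EuclideanSpace ℝ (Fin n) :=
  mfderiv (𝓡 n) (𝓡 n) (fun x : G => f.1 x) x

theorem derivAt_mul (f g : LieGroupAut n G) (x : G) :
    derivAt (f * g) x = derivAt f (g.1 x) ∘L derivAt g x :=
  mfderiv_comp (I' := 𝓡 n) x (mdifferentiableAt f (g.1 x)) (mdifferentiableAt g x)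

theorem derivAt_one (x : G) : derivAt (1 : LieGroupAut n G) x = .id ℝ _ :=
  mfderiv_id

theorem tangentMapOne_one (X : GroupLieAlgebra (𝓡 n) G) :
    tangentMapOne (1 : LieGroupAut n G) X = X :=
  DFunLike.congr_fun (derivAt_one (n := n) (1 : G)) X

theorem tangentMapOne_mul (f g : LieGroupAut n G) (X : GroupLieAlgebra (𝓡 n) G) :
    tangentMapOne (f * g) X = tangentMapOne f (tangentMapOne g X) := by
  have h := derivAt_mul f g 1
  rw [map_one] at h
  exact DFunLike.congr_fun h X

theorem inverse_derivAt (f : LieGroupAut n G) (x : G) :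
    (derivAt f x).inverse = derivAt f⁻¹ (f.1 x) := by
  have h1 := derivAt_mul f⁻¹ f x
  have h2 := derivAt_mul f f⁻¹ (f.1 x)
  rw [inv_mul_cancel, derivAt_one] at h1
  rw [mul_inv_cancel, derivAt_one] at h2
  have hx : (f⁻¹).1 (f.1 x) = x := f.1.symm_apply_apply x
  rw [hx] at h2
  exact ContinuousLinearMap.inverse_eq h2.symm h1.symm

theorem inverse_derivAt_apply (f : LieGroupAut n G) (x : G) (v : EuclideanSpace ℝ (Fin n)) :
    (derivAt f x).inverse (derivAt f x v) = v := by
  have h1 := derivAt_mul f⁻¹ f x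
  rw [inv_mul_cancel, derivAt_one] at h1
  rw [inverse_derivAt]
  exact (DFunLike.congr_fun h1 v).symm

theorem derivAt_inverse_apply (f : LieGroupAut n G) (x : G) (v : EuclideanSpace ℝ (Fin n)) :
    derivAt f x ((derivAt f x).inverse v) = v := by
  have h2 := derivAt_mul f f⁻¹ (f.1 x)
  rw [mul_inv_cancel, derivAt_one] at h2
  have hx : (f⁻¹).1 (f.1 x) = x := f.1.symm_apply_apply x
  rw [hx] at h2
  rw [inverse_derivAt]
  exact (DFunLike.congr_fun h2 v).symm

/-- Left-invariant vector fields are natural for automorphisms of `G`. -/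
theorem mpullback_mulInvariantVectorField_tangentMapOne [LieGroup (𝓡 n) ∞ G]
    (f : LieGroupAut n G) (X : GroupLieAlgebra (𝓡 n) G) :
    mpullback (𝓡 n) (𝓡 n) (fun x : G => f.1 x) (mulInvariantVectorField (tangentMapOne f X)) =
      mulInvariantVectorField X := by
  have hL : ∀ x y : G, MDifferentiableAt (𝓡 n) (𝓡 n) (x * ·) y := fun x y =>
    (contMDiff_mul_left (n := ∞)).mdifferentiable (by simp) y
  ext1 x
  -- the vector `X` is transported along the two sides of `f (x * y) = f x * f y`
  have h1 := mfderiv_comp (I' := 𝓡 n) (1 : G) (mdifferentiableAt f (x * 1)) (hL x 1)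
  have h2 := mfderiv_comp (I' := 𝓡 n) (1 : G) (hL (f.1 x) (f.1 1)) (mdifferentiableAt f 1)
  have h3 : (fun y : G => f.1 y) ∘ (x * ·) = (f.1 x * ·) ∘ fun y : G => f.1 y :=
    funext fun y => map_mul f.1 x y
  rw [h3, h2] at h1
  -- `f 1 = 1` cannot be rewritten in place, the tangent spaces depending on the base point
  have h4 : ∀ y : G, y = 1 → ∀ v : EuclideanSpace ℝ (Fin n),
      (mfderiv (𝓡 n) (𝓡 n) (f.1 x * ·) y : EuclideanSpace ℝ (Fin n) →L[ℝ] _) v =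
      (mfderiv (𝓡 n) (𝓡 n) (f.1 x * ·) 1 : EuclideanSpace ℝ (Fin n) →L[ℝ] _) v := by
    rintro _ rfl _; rfl
  have h5 : (mulInvariantVectorField (tangentMapOne f X) (f.1 x) : EuclideanSpace ℝ (Fin n)) =
      derivAt f (x * 1) (mulInvariantVectorField X x) :=
    (h4 (f.1 1) (map_one f) _).symm.trans (DFunLike.congr_fun h1 X)
  rw [mul_one] at h5
  have h6 := inverse_derivAt_apply f x (mulInvariantVectorField X x)
  rw [← h5] at h6
  exact h6

theorem tangentMapOne_lie [LieGroup (𝓡 n) ∞ G] (f : LieGroupAut n G)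
    (X Y : GroupLieAlgebra (𝓡 n) G) :
    tangentMapOne f ⁅X, Y⁆ = ⁅tangentMapOne f X, tangentMapOne f Y⁆ := by
  have h := mpullback_mlieBracket (n := minSmoothness ℝ 3) (x₀ := (1 : G))
    (mdifferentiableAt_mulInvariantVectorField (tangentMapOne f X) (g := f.1 1))
    (mdifferentiableAt_mulInvariantVectorField (tangentMapOne f Y) (g := f.1 1))
    (f.2.1.contMDiffAt.of_le ENat.LEInfty.out) (minSmoothness_monotone (by norm_cast))
  rw [mpullback_mulInvariantVectorField_tangentMapOne,
    mpullback_mulInvariantVectorField_tangentMapOne] at h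
  have h' : ∀ y : G, y = 1 →
      (mlieBracket (𝓡 n) (mulInvariantVectorField (tangentMapOne f X))
        (mulInvariantVectorField (tangentMapOne f Y)) y : EuclideanSpace ℝ (Fin n)) =
      ⁅tangentMapOne f X, tangentMapOne f Y⁆ := by
    rintro _ rfl; rfl
  rw [← h' _ (map_one f), GroupLieAlgebra.bracket_def, ← h]
  exact derivAt_inverse_apply f 1 _

/-- In the chart at `1`, an automorphism is strictly differentiable, with its tangent map as
derivative. -/
theorem hasStrictFDerivAt_extChartAt [LieGroup (𝓡 n) ∞ G] (f : LieGroupAut n G) :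
    HasStrictFDerivAt
      (fun y => extChartAt (𝓡 n) (1 : G) (f.1 ((extChartAt (𝓡 n) (1 : G)).symm y)))
      (derivAt f 1) (extChartAt (𝓡 n) (1 : G) 1) := by
  have h1 := (contMDiffAt_iff.1 (f.2.1.contMDiffAt (x := 1))).2
  have h2 := (mdifferentiableAt f 1).hasMFDerivAt.2
  simp only [writtenInExtChartAt] at h2
  rw [map_one] at h1 h2
  rw [ModelWithCorners.range_eq_univ] at h1 h2
  exact (contDiffWithinAt_univ.1 h1).hasStrictFDerivAt' (hasFDerivWithinAt_univ.1 h2) (by simp)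

/-- An automorphism of finite order with trivial tangent map fixes a neighbourhood of `1`. -/
theorem eventually_eq_self [LieGroup (𝓡 n) ∞ G] (f : LieGroupAut n G) {N : ℕ}
    (hN : N ≠ 0) (hf : f ^ N = 1) (h : ∀ X, tangentMapOne f X = X) :
    ∀ᶠ x in nhds (1 : G), f.1 x = x := by
  let φ := extChartAt (𝓡 n) (1 : G)
  -- the average, up to a factor `N`, of the chart over the powers of `f`
  let S : EuclideanSpace ℝ (Fin n) → EuclideanSpace ℝ (Fin n) := fun y =>
    ∑ k ∈ Finset.range N, φ ((f ^ k).1 (φ.symm y))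
  have hk : ∀ k, derivAt (f ^ k) 1 = .id ℝ _ := by
    intro k
    induction k with
    | zero => rw [pow_zero, derivAt_one]
    | succ k ih =>
      rw [pow_succ, derivAt_mul, map_one, ih]
      ext1 X
      exact h X
  -- the derivative of `S` is `N` times the identity, so `S` is injective near `φ 1`
  have hN' : (N : ℝ) ≠ 0 := Nat.cast_ne_zero.2 hN
  let e : EuclideanSpace ℝ (Fin n) ≃L[ℝ] EuclideanSpace ℝ (Fin n) :=
    ContinuousLinearEquiv.smulLeft (Units.mk0 (N : ℝ) hN')
  have he : ∑ _k ∈ Finset.range N, ContinuousLinearMap.id ℝ (EuclideanSpace ℝ (Fin n)) = e := by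
    ext1 v
    rw [Finset.sum_const, Finset.card_range, ← Nat.cast_smul_eq_nsmul ℝ]
    rfl
  have hS : HasStrictFDerivAt S (e : EuclideanSpace ℝ (Fin n) →L[ℝ] _) (φ 1) := by
    rw [← he]
    exact HasStrictFDerivAt.fun_sum fun k _ => hk k ▸ hasStrictFDerivAt_extChartAt (f ^ k)
  have hφ : Filter.Tendsto φ (nhds 1) (nhds (φ 1)) := continuousAt_extChartAt (I := 𝓡 n) (1 : G)
  have hf1 : Filter.Tendsto (fun x : G => f.1 x) (nhds 1) (nhds 1) := by
    have := f.2.1.continuous.tendsto 1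
    rwa [map_one] at this
  have hsrc : φ.source ∈ nhds (1 : G) := extChartAt_source_mem_nhds (I := 𝓡 n) (1 : G)
  have hinv := hφ.eventually hS.eventually_left_inverse
  filter_upwards [hsrc, hf1.eventually hsrc, hinv, hf1.eventually hinv] with x hx hfx h1 h2
  -- `S ∘ φ` is invariant under `f`, since `f` permutes the summands
  have hSf : S (φ (f.1 x)) = S (φ x) := by
    simp only [S]
    rw [φ.left_inv hx, φ.left_inv hfx]
    have hstep : ∀ k, (f ^ k).1 (f.1 x) = (f ^ (k + 1)).1 x := by
      intro k
      rw [pow_succ]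
      rfl
    have hend : (f ^ N).1 x = (f ^ 0).1 x := by rw [hf, pow_zero]
    simp_rw [hstep]
    have h3 := Finset.sum_range_succ (fun k => φ ((f ^ k).1 x)) N
    rw [Finset.sum_range_succ', hend] at h3
    exact add_right_cancel h3
  apply φ.injOn hfx hx
  exact h2.symm.trans ((congrArg _ hSf).trans h1)

theorem eq_one_of_tangentMapOne_eq [LieGroup (𝓡 n) ∞ G] [ConnectedSpace G]
    (f : LieGroupAut n G) {N : ℕ} (hN : N ≠ 0) (hf : f ^ N = 1)
    (h : ∀ X, tangentMapOne f X = X) : f = 1 := by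
  have : IsTopologicalGroup G := topologicalGroup_of_lieGroup (𝓡 n) ∞
  have hmem : ((f.1 : G →* G).eqLocus (MonoidHom.id G) : Set G) ∈ nhds (1 : G) :=
    eventually_eq_self f hN hf h
  have hopen := Subgroup.isOpen_of_mem_nhds _ hmem
  have htop : ((f.1 : G →* G).eqLocus (MonoidHom.id G) : Set G) = Set.univ :=
    IsClopen.eq_univ ⟨Subgroup.isClosed_of_isOpen _ hopen, hopen⟩ ⟨1, one_mem _⟩
  apply Subtype.ext
  ext x
  have hx : x ∈ ((f.1 : G →* G).eqLocus (MonoidHom.id G) : Set G) := htop ▸ Set.mem_univ x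
  exact hx

/-- The action `γ ↦ (T ρ_γ)_1` of `Γ` on the Lie algebra of `G`. -/
noncomputable def tangentAction [LieGroup (𝓡 n) ∞ G] {Γ : Type*} [Group Γ]
    (ρ : Γ →* LieGroupAut n G) :
    Γ →* (GroupLieAlgebra (𝓡 n) G ≃ₗ⁅ℝ⁆ GroupLieAlgebra (𝓡 n) G) where
  toFun γ :=
    { derivAt (ρ γ) 1 with
      map_lie' := tangentMapOne_lie (ρ γ) _ _
      invFun := tangentMapOne (ρ γ⁻¹)
      left_inv := fun X => by
        change tangentMapOne (ρ γ⁻¹) (tangentMapOne (ρ γ) X) = X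
        rw [← tangentMapOne_mul, ← map_mul, inv_mul_cancel, _root_.map_one,
          tangentMapOne_one]
      right_inv := fun X => by
        change tangentMapOne (ρ γ) (tangentMapOne (ρ γ⁻¹) X) = X
        rw [← tangentMapOne_mul, ← map_mul, mul_inv_cancel, _root_.map_one,
          tangentMapOne_one] }
  map_one' := by
    ext X
    change tangentMapOne (ρ 1) X = X
    rw [_root_.map_one, tangentMapOne_one]
  map_mul' γ δ := by
    ext X
    change tangentMapOne (ρ (γ * δ)) X = tangentMapOne (ρ γ) (tangentMapOne (ρ δ) X)
    rw [map_mul, tangentMapOne_mul]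

theorem tangentAction_apply [LieGroup (𝓡 n) ∞ G] {Γ : Type*} [Group Γ]
    (ρ : Γ →* LieGroupAut n G) (γ : Γ) (X : GroupLieAlgebra (𝓡 n) G) :
    tangentAction ρ γ X = tangentMapOne (ρ γ) X := rfl

theorem tangentAction_injective [LieGroup (𝓡 n) ∞ G] [ConnectedSpace G] {Γ : Type*} [Group Γ]
    [Finite Γ] {ρ : Γ →* LieGroupAut n G} (hρ : Function.Injective ρ) :
    Function.Injective (tangentAction ρ) := by
  refine (injective_iff_map_eq_one _).2 fun γ hγ => hρ ?_
  rw [_root_.map_one]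
  refine eq_one_of_tangentMapOne_eq (ρ γ) (orderOf_pos γ).ne' ?_ fun X => ?_
  · rw [← map_pow, pow_orderOf_eq_one, _root_.map_one]
  · rw [← tangentAction_apply, hγ]; rfl

end LieGroupAut

/-! ### The gradings defined by a `Γ`-symmetric space -/

theorem mainTheorem4 {n : ℕ} {G : Type*} [Group G] [TopologicalSpace G]
    [ChartedSpace (EuclideanSpace ℝ (Fin n)) G] [LieGroup (𝓡 n) ∞ G]
    {Γ : Type*} [CommGroup Γ] [Finite Γ]
    (H : Subgroup G) (ρ : Γ →* LieGroupAut n G) (hGH : IsGammaSymmetricSpace H ρ) :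
    ∃ τ : Γ →* (GroupLieAlgebra (𝓡 n) G ≃ₗ⁅ℝ⁆ GroupLieAlgebra (𝓡 n) G),
      (∀ (γ : Γ) (X : GroupLieAlgebra (𝓡 n) G), τ γ X = LieGroupAut.tangentMapOne (ρ γ) X) ∧
      Function.Injective τ ∧
      (IsLieGrading (complexComponent τ) ∧
        Subgroup.closure (gradingSupport (complexComponent τ)) = ⊤) ∧
      (∀ k : ℕ, Nonempty (Γ ≃* Multiplicative (Fin k → ZMod 2)) →
        IsLieGrading (realComponent τ) ∧
          Subgroup.closure (gradingSupport (realComponent τ)) = ⊤) := by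
  have := hGH.connected
  have hτ := LieGroupAut.tangentAction_injective hGH.injective
  refine ⟨LieGroupAut.tangentAction ρ, LieGroupAut.tangentAction_apply ρ, hτ, ?_, ?_⟩
  · rw [complexComponent_eq]
    exact ⟨isLieGrading_weightSubmodule _ (complexLinearAction_lie _) _ complexWeight_eq_one_iff,
      closure_support_weightSubmodule _ (complexLinearAction_injective hτ) _
        complexWeight_eq_one_iff⟩
  · rintro k ⟨e⟩
    have hΓ : ∀ γ : Γ, γ ^ 2 = 1 := by
      intro γ
      apply e.injective
      rw [map_pow, map_one, ← toAdd_eq_zero, toAdd_pow]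
      ext i
      exact ZModModule.char_nsmul_eq_zero 2 _
    rw [realComponent_eq _ hΓ]
    exact ⟨isLieGrading_weightSubmodule _ (fun γ => LieEquiv.map_lie _) _
        (realWeight_eq_one_iff hΓ),
      closure_support_weightSubmodule _ (linearAction_injective hτ) _
        (realWeight_eq_one_iff hΓ)⟩
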